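/- Let $n\ge 1$ and $d\ge 0$ be integers, let $T_1,\dots,T_n\in M_d(\mathbb C)$ be positive semidefinite matrices, and let $\vartheta_1,\dots,\vartheta_n$ be real numbers with $0\le\vartheta_k\le 1$ for every $k$ and $\sum_{k=1}^n\vartheta_k=1$. Put $r=\min\{\vartheta_k : k=1,\dots,n\}$. Then $$\sum_{k=1}^{n}\operatorname{tr}(\vartheta_k T_k)\;\ge\;\operatorname{tr}\left|\,\prod_{k=1}^{n}T_k^{\vartheta_k}\right|+r\left(\sum_{k=1}^{n}\operatorname{tr}(T_k)-n\sqrt[n]{\prod_{k=1}^{n}\operatorname{tr}(T_k)}\right).$$ Here $T^{\vartheta}$ is the power of a positive semidefinite matrix given by the functional calculus (with $T^0=I$), the product is taken in the order $T_1^{\vartheta_1}T_2^{\vartheta_2}\cdots T_n^{\vartheta_n}$, and $|A|=(A^*A)^{1/2}$. -/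

import Mathlib

open scoped MatrixOrder ComplexOrder

/-! The claim splits into Hölder's inequality tr|∏ T_k^ϑ_k| ≤ ∏ (tr T_k)^ϑ_k and a refined scalar
AM-GM for the numbers tr T_k. For Hölder, write |A| = W A with W a contraction, so that only |tr(W
A)| needs a bound. Replacing the exponents by complex z_k makes this trace holomorphic. At a vertex
of the simplex of real parts one factor has trace norm at most tr T_k and the others are
contractions; the three lines theorem shows that the set of exponents where the bound holds is
convex, so it contains the whole simplex. -/

/-- The weighted AM-GM inequality, refined by a multiple of the gap in the unweighted one. -/
theorem geom_mean_add_gap_le_arith_mean_weighted {n : ℕ} (a ϑ : Fin n → ℝ)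
    (ha : ∀ k, 0 ≤ a k) (hsum : ∑ k, ϑ k = 1) (r : ℝ) (hr₀ : 0 ≤ r) (hr : ∀ k, r ≤ ϑ k) :
    ∏ k, a k ^ ϑ k + r * (∑ k, a k - (n : ℝ) * (∏ k, a k) ^ (1 / (n : ℝ)))
      ≤ ∑ k, ϑ k * a k := by
  have hn : (n : ℝ) ≠ 0 := by
    rintro h
    obtain rfl : n = 0 := by exact_mod_cast h
    simp at hsum
  have hP : 0 ≤ ∏ k, a k := Finset.prod_nonneg fun k _ => ha k
  -- AM-GM on n + 1 points: the extra one is the unweighted geometric mean, with weight n r, and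
  -- each a k keeps weight ϑ k - r.
  have key := Real.geom_mean_le_arith_mean_weighted (Finset.univ : Finset (Option (Fin n)))
    (fun o => o.elim (n * r) fun k => ϑ k - r)
    (fun o => o.elim ((∏ k, a k) ^ (1 / (n : ℝ))) a)
    (by
      rintro (_ | k) -
      · exact mul_nonneg n.cast_nonneg hr₀
      · exact sub_nonneg.2 (hr k))
    (by simp [Fintype.sum_option, hsum])
    (by
      rintro (_ | k) -
      · exact Real.rpow_nonneg hP _
      · exact ha k)
  simp only [Fintype.prod_option, Fintype.sum_option, Option.elim] at key
  have hprod : ((∏ k, a k) ^ (1 / (n : ℝ))) ^ (n * r) * ∏ k, a k ^ (ϑ k - r)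
      = ∏ k, a k ^ ϑ k := by
    rw [← Real.rpow_mul hP, one_div, inv_mul_cancel_left₀ hn,
      ← Real.finsetProd_rpow _ _ (fun k _ => ha k), ← Finset.prod_mul_distrib]
    refine Finset.prod_congr rfl fun k _ => ?_
    rw [← Real.rpow_add_of_nonneg (ha k) hr₀ (sub_nonneg.2 (hr k)), add_sub_cancel]
  rw [hprod] at key
  simp only [sub_mul, Finset.sum_sub_distrib, ← Finset.mul_sum] at key
  linarith

namespace Matrix

/-! ### Operator norm and trace bounds -/

section OperatorNorm

open scoped Matrix.Norms.L2Operator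

variable {m : Type*} [Fintype m] [DecidableEq m]

theorem l2_opNorm_one_le : ‖(1 : Matrix m m ℂ)‖ ≤ 1 := by
  rw [← diagonal_one, l2_opNorm_diagonal]
  exact (pi_norm_le_iff_of_nonneg zero_le_one).2 fun i => by simp

theorem norm_entry_le_l2_opNorm (A : Matrix m m ℂ) (i j : m) : ‖A i j‖ ≤ ‖A‖ := by
  have h := A.l2_opNorm_mulVec (EuclideanSpace.single j (1 : ℂ))
  rw [PiLp.norm_single, norm_one, mul_one] at h
  refine le_trans ?_ h
  have := PiLp.norm_apply_le (p := 2)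
    ((EuclideanSpace.equiv m ℂ).symm (A *ᵥ (EuclideanSpace.single j (1 : ℂ)))) i
  simpa using this

theorem l2_opNorm_le_one_of_mem_unitary (U : unitaryGroup m ℂ) :
    ‖(U : Matrix m m ℂ)‖ ≤ 1 := by
  have h := l2_opNorm_conjTranspose_mul_self (U : Matrix m m ℂ)
  have hU : (U : Matrix m m ℂ)ᴴ * U = 1 := Unitary.coe_star_mul_self U
  rw [hU] at h
  have := l2_opNorm_one_le (m := m)
  nlinarith [norm_nonneg (U : Matrix m m ℂ)]

theorem l2_opNorm_star_le_one_of_mem_unitary (U : unitaryGroup m ℂ) :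
    ‖star (U : Matrix m m ℂ)‖ ≤ 1 := by
  rw [star_eq_conjTranspose, l2_opNorm_conjTranspose]
  exact l2_opNorm_le_one_of_mem_unitary U

theorem l2_opNorm_unitary_conj_diagonal_le (U : unitaryGroup m ℂ) (v : m → ℂ) {C : ℝ}
    (hC : 0 ≤ C) (hv : ∀ i, ‖v i‖ ≤ C) :
    ‖(U : Matrix m m ℂ) * diagonal v * star (U : Matrix m m ℂ)‖ ≤ C := by
  have hd : ‖(diagonal v : Matrix m m ℂ)‖ ≤ C := by
    rw [l2_opNorm_diagonal]
    exact (pi_norm_le_iff_of_nonneg hC).2 hv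
  calc _ ≤ ‖(U : Matrix m m ℂ)‖ * ‖(diagonal v : Matrix m m ℂ)‖
        * ‖star (U : Matrix m m ℂ)‖ := norm_mul₃_le
    _ ≤ 1 * C * 1 := by
        gcongr
        · exact l2_opNorm_le_one_of_mem_unitary U
        · exact l2_opNorm_star_le_one_of_mem_unitary U
    _ = C := by ring

/-- Trace norm duality: by cyclicity only the diagonal entries of U* X U matter, and each is at most
‖X‖. -/
theorem norm_trace_mul_unitary_conj_diagonal_le (X : Matrix m m ℂ) (U : unitaryGroup m ℂ)
    (v : m → ℂ) :
    ‖(X * ((U : Matrix m m ℂ) * diagonal v * star (U : Matrix m m ℂ))).trace‖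
      ≤ ‖X‖ * ∑ i, ‖v i‖ := by
  have hY : ‖star (U : Matrix m m ℂ) * X * U‖ ≤ ‖X‖ := by
    calc _ ≤ ‖star (U : Matrix m m ℂ)‖ * ‖X‖ * ‖(U : Matrix m m ℂ)‖ := norm_mul₃_le
      _ ≤ 1 * ‖X‖ * 1 := by
        gcongr
        · exact l2_opNorm_star_le_one_of_mem_unitary U
        · exact l2_opNorm_le_one_of_mem_unitary U
      _ = ‖X‖ := by ring
  have htr : (X * ((U : Matrix m m ℂ) * diagonal v * star (U : Matrix m m ℂ))).trace
      = ∑ i, (star (U : Matrix m m ℂ) * X * U) i i * v i := by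
    rw [← Matrix.mul_assoc, trace_mul_comm, ← Matrix.mul_assoc, ← Matrix.mul_assoc]
    simp [trace, mul_diagonal]
  rw [htr, Finset.mul_sum]
  refine (norm_sum_le _ _).trans (Finset.sum_le_sum fun i _ => ?_)
  rw [norm_mul]
  gcongr
  exact (norm_entry_le_l2_opNorm _ i i).trans hY

/-- A Hermitian square root of `AᴴA` is a contraction times `A`. -/
theorem exists_contraction_mul_eq {P A : Matrix m m ℂ} (hP : P.IsHermitian)
    (h : P * P = Aᴴ * A) : ∃ W : Matrix m m ℂ, ‖W‖ ≤ 1 ∧ P = W * A := by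
  obtain ⟨U, v, hPv⟩ : ∃ (U : unitaryGroup m ℂ) (v : m → ℝ),
      P = U * diagonal (fun i => (v i : ℂ)) * star (U : Matrix m m ℂ) :=
    ⟨hP.eigenvectorUnitary, hP.eigenvalues, by
      conv_lhs => rw [hP.spectral_theorem, Unitary.conjStarAlgAut_apply]
      rfl⟩
  have hconj : ∀ f g : m → ℂ, ((U : Matrix m m ℂ) * diagonal f * star (U : Matrix m m ℂ)) *
      ((U : Matrix m m ℂ) * diagonal g * star (U : Matrix m m ℂ)) =
      (U : Matrix m m ℂ) * diagonal (fun i => f i * g i) * star (U : Matrix m m ℂ) := by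
    intro f g
    calc _ = (U : Matrix m m ℂ) * diagonal f * (star (U : Matrix m m ℂ) * U) * diagonal g
          * star (U : Matrix m m ℂ) := by simp only [Matrix.mul_assoc]
      _ = _ := by
        rw [Unitary.coe_star_mul_self, Matrix.mul_one, Matrix.mul_assoc (U : Matrix m m ℂ),
          diagonal_mul_diagonal]
  -- Since 0⁻¹ = 0, Q is the pseudo-inverse of P: Q P² = P, and P Q is a projection. The contraction
  -- is Q Aᴴ.
  set Q : Matrix m m ℂ := U * diagonal (fun i => ((v i)⁻¹ : ℂ)) * star (U : Matrix m m ℂ) with hQ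
  have hQH : Qᴴ = Q := by
    rw [hQ, conjTranspose_mul, conjTranspose_mul, diagonal_conjTranspose, star_eq_conjTranspose,
      conjTranspose_conjTranspose, Matrix.mul_assoc]
    congr 3
    ext i
    simp
  have hcancel : Q * (P * P) = P := by
    rw [hPv, hQ, hconj, hconj]
    congr 3
    ext i
    by_cases hv : (v i : ℂ) = 0
    · simp [hv]
    · rw [inv_mul_cancel_left₀ hv]
  refine ⟨Q * Aᴴ, ?_, by rw [Matrix.mul_assoc, ← h, hcancel]⟩
  have hsq := l2_opNorm_conjTranspose_mul_self (A * Q)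
  have hPQ : ‖P * Q‖ ≤ 1 := by
    rw [hPv, hQ, hconj]
    refine l2_opNorm_unitary_conj_diagonal_le U _ zero_le_one fun i => ?_
    by_cases hv : (v i : ℂ) = 0
    · simp [hv]
    · rw [mul_inv_cancel₀ hv, norm_one]
  have heq : (A * Q)ᴴ * (A * Q) = P * Q := by
    rw [conjTranspose_mul, hQH, Matrix.mul_assoc, ← Matrix.mul_assoc Aᴴ, ← h,
      ← Matrix.mul_assoc, hcancel]
  have hnorm : ‖Q * Aᴴ‖ = ‖A * Q‖ := by
    rw [← l2_opNorm_conjTranspose (A * Q), conjTranspose_mul, hQH]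
  rw [heq] at hsq
  rw [hnorm]
  nlinarith [norm_nonneg (A * Q)]

theorem exists_l2_opNorm_prod_ofFn_le {n : ℕ} (C : Fin n → ℝ) :
    ∃ K : ℝ, ∀ M : Fin n → Matrix m m ℂ, (∀ k, ‖M k‖ ≤ C k) → ‖(List.ofFn M).prod‖ ≤ K := by
  induction n with
  | zero => exact ⟨‖(1 : Matrix m m ℂ)‖, fun M _ => by simp⟩
  | succ n ih =>
    obtain ⟨K, hK⟩ := ih fun k => C k.succ
    refine ⟨C 0 * K, fun M hM => ?_⟩
    rw [List.ofFn_succ, List.prod_cons]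
    refine (norm_mul_le _ _).trans ?_
    have := hK (fun k => M k.succ) fun k => hM _
    exact mul_le_mul (hM 0) this (norm_nonneg _) ((norm_nonneg _).trans (hM 0))

theorem l2_opNorm_prod_ofFn_le_one {n : ℕ} (M : Fin n → Matrix m m ℂ) (hM : ∀ k, ‖M k‖ ≤ 1) :
    ‖(List.ofFn M).prod‖ ≤ 1 := by
  induction n with
  | zero => simpa using l2_opNorm_one_le
  | succ n ih =>
    rw [List.ofFn_succ, List.prod_cons]
    exact (norm_mul_le _ _).trans
      (mul_le_one₀ (hM 0) (norm_nonneg _) (ih _ fun k => hM _))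

theorem exists_contractions_prod_ofFn_eq {n : ℕ} (M : Fin n → Matrix m m ℂ) (j : Fin n)
    (hM : ∀ k, k ≠ j → ‖M k‖ ≤ 1) :
    ∃ X Y : Matrix m m ℂ, ‖X‖ ≤ 1 ∧ ‖Y‖ ≤ 1 ∧ (List.ofFn M).prod = X * M j * Y := by
  induction n with
  | zero => exact j.elim0
  | succ n ih =>
    rw [List.ofFn_succ, List.prod_cons]
    cases j using Fin.cases with
    | zero =>
      exact ⟨1, _, l2_opNorm_one_le,
        l2_opNorm_prod_ofFn_le_one _ fun k => hM _ (Fin.succ_ne_zero k), by rw [Matrix.one_mul]⟩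
    | succ j =>
      obtain ⟨X, Y, hX, hY, h⟩ := ih (fun k => M k.succ) j
        fun k hk => hM _ fun h => hk (Fin.succ_injective _ h)
      refine ⟨M 0 * X, Y, (norm_mul_le _ _).trans
        (mul_le_one₀ (hM 0 (Fin.succ_ne_zero j).symm) (norm_nonneg _) hX), hY, ?_⟩
      rw [h]
      simp only [Matrix.mul_assoc]

theorem differentiable_prod_ofFn {n : ℕ} (M : Fin n → ℂ → Matrix m m ℂ)
    (hM : ∀ k, Differentiable ℂ (M k)) :
    Differentiable ℂ fun w => (List.ofFn fun k => M k w).prod := by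
  induction n with
  | zero => simp
  | succ n ih =>
    simp only [List.ofFn_succ, List.prod_cons]
    exact (hM 0).mul (ih _ fun k => hM _)

theorem differentiable_trace_mul {f : ℂ → Matrix m m ℂ} (W : Matrix m m ℂ)
    (hf : Differentiable ℂ f) : Differentiable ℂ fun w => (W * f w).trace := by
  let L : Matrix m m ℂ →ₗ[ℂ] ℂ := traceLinearMap m ℂ ℂ ∘ₗ LinearMap.mulLeft ℂ W
  exact (LinearMap.toContinuousLinearMap L).differentiable.comp hf

theorem exists_norm_trace_le : ∃ K : ℝ, 0 ≤ K ∧ ∀ A : Matrix m m ℂ, ‖A.trace‖ ≤ K * ‖A‖ :=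
  ⟨Fintype.card m, Nat.cast_nonneg _, fun A => by
    refine (norm_sum_le_of_le _ fun i _ => norm_entry_le_l2_opNorm A i i).trans ?_
    simp⟩

/-- Complex interpolation over the standard simplex, for a product of holomorphic matrix
families that are contractions on the line `re z = 0` and bounded in trace norm on `re z = 1`. -/
theorem norm_trace_prod_ofFn_le_of_mem_stdSimplex {n : ℕ} (A : Fin n → ℂ → Matrix m m ℂ)
    (c : Fin n → ℝ) (hc : ∀ k, 0 ≤ c k) (hA : ∀ k, Differentiable ℂ (A k))
    (hbdd : ∀ k, ∃ C : ℝ, ∀ z : ℂ, 0 ≤ z.re → z.re ≤ 1 → ‖A k z‖ ≤ C)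
    (h₀ : ∀ k z, z.re = 0 → ‖A k z‖ ≤ 1)
    (h₁ : ∀ k z X, z.re = 1 → ‖(X * A k z).trace‖ ≤ ‖X‖ * c k)
    (W : Matrix m m ℂ) (hW : ‖W‖ ≤ 1) (x : Fin n → ℝ) (hx : x ∈ stdSimplex ℝ (Fin n)) :
    ‖(W * (List.ofFn fun k => A k (x k)).prod).trace‖ ≤ ∏ k, c k ^ x k := by
  choose C hC using hbdd
  -- Arbitrary imaginary parts are allowed so that membership of a and b controls the full boundary
  -- lines of the strip.
  let S : Set (Fin n → ℝ) := {x | (∀ k, 0 ≤ x k ∧ x k ≤ 1) ∧ ∀ z : Fin n → ℂ,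
    (∀ k, (z k).re = x k) → ‖(W * (List.ofFn fun k => A k (z k)).prod).trace‖ ≤ ∏ k, c k ^ x k}
  suffices hS : stdSimplex ℝ (Fin n) ⊆ S from (hS hx).2 _ fun k => Complex.ofReal_re _
  rw [← convexHull_basis_eq_stdSimplex]
  refine convexHull_min ?_ ?_
  · rintro _ ⟨j, rfl⟩
    refine ⟨fun k => by dsimp only; split_ifs <;> simp, fun z hz => ?_⟩
    obtain ⟨X, Y, hX, hY, h⟩ := exists_contractions_prod_ofFn_eq (fun k => A k (z k)) j
      fun k hk => h₀ k _ (by simp [hz, hk.symm])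
    have hprod : ∏ k, c k ^ (if j = k then (1 : ℝ) else 0) = c j := by
      rw [Finset.prod_eq_single j]
      · simp
      · intro k _ hk
        simp [hk.symm]
      · simp
    rw [hprod, h, ← Matrix.mul_assoc, trace_mul_comm, ← Matrix.mul_assoc, ← Matrix.mul_assoc]
    refine (h₁ j _ _ (by simp [hz])).trans ?_
    refine mul_le_of_le_one_left (hc j) ?_
    calc _ ≤ ‖Y‖ * ‖W‖ * ‖X‖ := norm_mul₃_le
      _ ≤ 1 * 1 * 1 := by gcongr
      _ = 1 := by norm_num
  · rintro a ⟨ha, hFa⟩ b ⟨hb, hFb⟩ s t hs ht hst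
    refine ⟨fun k => ?_, fun z hz => ?_⟩
    · simp only [Pi.add_apply, Pi.smul_apply, smul_eq_mul]
      obtain rfl : s = 1 - t := by linarith
      constructor
      · nlinarith [(ha k).1, (hb k).1]
      · nlinarith [(ha k).2, (hb k).2]
    · obtain rfl : s = 1 - t := by linarith
      -- Real parts run from a to b as w crosses the strip; the constant imaginary shift makes ζ k t
      -- = z k.
      let ζ : Fin n → ℂ → ℂ := fun k w => a k + (w : ℂ) * (b k - a k) + (z k).im * Complex.I
      have hζre : ∀ k w, (ζ k w).re = a k + w.re * (b k - a k) := fun k w => by simp [ζ]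
      let f : ℂ → ℂ := fun w => (W * (List.ofFn fun k => A k (ζ k w)).prod).trace
      have hfd : Differentiable ℂ f := differentiable_trace_mul W
        (differentiable_prod_ofFn _ fun k => (hA k).comp (by fun_prop))
      obtain ⟨K, hK⟩ := exists_l2_opNorm_prod_ofFn_le (m := m) C
      obtain ⟨K', hK'₀, hK'⟩ := exists_norm_trace_le (m := m)
      have hmem : (t : ℂ) ∈ Complex.HadamardThreeLines.verticalClosedStrip 0 1 := by
        constructor <;> simp <;> linarith
      have key := Complex.HadamardThreeLines.norm_le_interp_of_mem_verticalClosedStrip'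
        (f := f) (a := ∏ k, c k ^ a k) (b := ∏ k, c k ^ b k) zero_lt_one hmem
        hfd.diffContOnCl
        (by
          refine ⟨K' * (1 * K), ?_⟩
          rintro _ ⟨w, hw, rfl⟩
          have hw' : 0 ≤ w.re ∧ w.re ≤ 1 := hw
          refine (hK' _).trans (mul_le_mul_of_nonneg_left ?_ hK'₀)
          refine (norm_mul_le _ _).trans ?_
          refine mul_le_mul hW (hK _ fun k => hC k _ ?_ ?_) (norm_nonneg _) zero_le_one
          · rw [hζre]
            nlinarith [(ha k).1, (hb k).1]
          · rw [hζre]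
            nlinarith [(ha k).2, (hb k).2])
        (fun w hw => hFa _ fun k => by
          have : w.re = 0 := hw
          simp [hζre, this])
        (fun w hw => hFb _ fun k => by
          have : w.re = 1 := hw
          simp [hζre, this])
      have hft : f t = (W * (List.ofFn fun k => A k (z k)).prod).trace := by
        have : ∀ k, ζ k t = z k := fun k => by
          apply Complex.ext
          · rw [hζre, hz]
            simp
            ring
          · simp [ζ]
        simp only [f, this]
      rw [hft] at key
      refine key.trans_eq ?_
      simp only [Complex.ofReal_re, sub_zero, div_one]
      rw [← Real.finsetProd_rpow _ _ fun k _ => Real.rpow_nonneg (hc k) _,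
        ← Real.finsetProd_rpow _ _ fun k _ => Real.rpow_nonneg (hc k) _,
        ← Finset.prod_mul_distrib]
      refine Finset.prod_congr rfl fun k _ => ?_
      rw [← Real.rpow_mul (hc k), ← Real.rpow_mul (hc k), ← Real.rpow_add_of_nonneg (hc k)
        (mul_nonneg (ha k).1 hs) (mul_nonneg (hb k).1 ht)]
      congr 1
      simp only [Pi.add_apply, Pi.smul_apply, smul_eq_mul]
      ring

/-- The entire function `z ↦ t ^ z`, with the value `0` for `t = 0`. -/
noncomputable def entirePow (t : ℝ) (z : ℂ) : ℂ := if t = 0 then 0 else (t : ℂ) ^ z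

theorem differentiable_entirePow (t : ℝ) : Differentiable ℂ (entirePow t) := by
  unfold entirePow
  by_cases ht : t = 0
  · simp [ht]
  · simp only [ht, if_false]
    exact fun z => (differentiableAt_id).const_cpow (Or.inl (by exact_mod_cast ht))

theorem norm_entirePow_le {t : ℝ} (ht : 0 ≤ t) (z : ℂ) : ‖entirePow t z‖ ≤ t ^ z.re := by
  unfold entirePow
  split_ifs with h
  · simpa using Real.rpow_nonneg ht _
  · rw [Complex.norm_cpow_eq_rpow_re_of_pos (lt_of_le_of_ne ht (Ne.symm h))]

theorem entirePow_ofReal {t x : ℝ} (ht : 0 ≤ t) (h : t ≠ 0 ∨ x ≠ 0) :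
    entirePow t x = ((t ^ x : ℝ) : ℂ) := by
  unfold entirePow
  split_ifs with h0
  · rw [h0, Real.zero_rpow (h.resolve_left (not_not.2 h0)), Complex.ofReal_zero]
  · rw [Complex.ofReal_cpow ht]

/-- **Hölder's inequality** for the trace of a product of powers in diagonalised form. -/
theorem norm_trace_mul_prod_unitary_conj_le {n : ℕ} (U : Fin n → unitaryGroup m ℂ)
    (v : Fin n → m → ℝ) (hv : ∀ k i, 0 ≤ v k i) (x : Fin n → ℝ)
    (hx : x ∈ stdSimplex ℝ (Fin n)) (hvx : ∀ k i, v k i ≠ 0 ∨ x k ≠ 0)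
    (W : Matrix m m ℂ) (hW : ‖W‖ ≤ 1) :
    ‖(W * (List.ofFn fun k => (U k : Matrix m m ℂ) *
        diagonal (fun i => ((v k i ^ x k : ℝ) : ℂ)) * star (U k : Matrix m m ℂ)).prod).trace‖
      ≤ ∏ k, (∑ i, v k i) ^ x k := by
  let A : Fin n → ℂ → Matrix m m ℂ := fun k z => (U k : Matrix m m ℂ) *
    diagonal (fun i => entirePow (v k i) z) * star (U k : Matrix m m ℂ)
  have hA : ∀ k, (U k : Matrix m m ℂ) * diagonal (fun i => ((v k i ^ x k : ℝ) : ℂ)) *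
      star (U k : Matrix m m ℂ) = A k (x k) := fun k => by
    simp only [A, entirePow_ofReal (hv k _) (hvx k _)]
  simp only [hA]
  refine norm_trace_prod_ofFn_le_of_mem_stdSimplex A _
    (fun k => Finset.sum_nonneg fun i _ => hv k i) ?_ ?_ ?_ ?_ W hW x hx
  · intro k
    have hd : Differentiable ℂ fun z =>
        (diagonal (fun i => entirePow (v k i) z) : Matrix m m ℂ) := by
      have : Differentiable ℂ fun z => fun i => entirePow (v k i) z :=
        differentiable_pi.2 fun i => differentiable_entirePow _
      exact (LinearMap.toContinuousLinearMap (diagonalLinearMap m ℂ ℂ)).differentiable.comp this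
    exact ((differentiable_const _).mul hd).mul (differentiable_const _)
  · intro k
    refine ⟨1 + ∑ i, v k i, fun z hz₀ hz₁ => ?_⟩
    have hs : 0 ≤ ∑ i, v k i := Finset.sum_nonneg fun i _ => hv k i
    refine l2_opNorm_unitary_conj_diagonal_le _ _ (by linarith) fun i => ?_
    refine (norm_entirePow_le (hv k i) z).trans ?_
    have hi : v k i ≤ ∑ i, v k i := Finset.single_le_sum (fun i _ => hv k i) (Finset.mem_univ i)
    rcases le_total (v k i) 1 with h | h
    · exact (Real.rpow_le_one (hv k i) h hz₀).trans (by linarith)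
    · refine (Real.rpow_le_rpow_of_exponent_le h hz₁).trans ?_
      rw [Real.rpow_one]
      linarith
  · intro k z hz
    refine l2_opNorm_unitary_conj_diagonal_le _ _ zero_le_one fun i => ?_
    simpa [hz] using norm_entirePow_le (hv k i) z
  · intro k z X hz
    refine (norm_trace_mul_unitary_conj_diagonal_le X _ _).trans ?_
    gcongr with i
    simpa [hz] using norm_entirePow_le (hv k i) z

end OperatorNorm

/-! ### Passage to positive semidefinite powers -/

variable {m : Type*} [Fintype m] [DecidableEq m]

theorem PosSemidef.exists_rpow_eq {T : Matrix m m ℂ} (hT : T.PosSemidef) {x : ℝ} :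
    ∃ (U : unitaryGroup m ℂ) (v : m → ℝ), (∀ i, 0 ≤ v i) ∧ (∀ i, v i ≠ 0 ∨ x ≠ 0) ∧
      (∑ i, v i) ^ x = T.trace.re ^ x ∧
      T ^ x = (U : Matrix m m ℂ) * diagonal (fun i => ((v i ^ x : ℝ) : ℂ)) *
        star (U : Matrix m m ℂ) := by
  by_cases hx : x = 0
  · subst hx
    -- T ^ 0 = 1 even on the kernel of T, where `entirePow` would give 0; hence the substitute
    -- eigenvalues 1.
    refine ⟨1, fun _ => 1, fun _ => zero_le_one, fun _ => Or.inl one_ne_zero, by simp, ?_⟩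
    rw [CFC.rpow_zero T hT.nonneg]
    simp
  · refine ⟨hT.1.eigenvectorUnitary, hT.1.eigenvalues, hT.eigenvalues_nonneg,
      fun _ => Or.inr hx, ?_, ?_⟩
    · rw [hT.1.trace_eq_sum_eigenvalues]
      simp
    · rw [CFC.rpow_eq_cfc_real hT.nonneg, hT.1.cfc_eq, IsHermitian.cfc,
        Unitary.conjStarAlgAut_apply]
      rfl

/-- **Hölder's inequality** for the trace norm of a product of powers of positive semidefinite
matrices. -/
theorem re_trace_abs_prod_rpow_le {n : ℕ} (T : Fin n → Matrix m m ℂ)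
    (hT : ∀ k, (T k).PosSemidef) (x : Fin n → ℝ) (hx : x ∈ stdSimplex ℝ (Fin n)) :
    (CFC.abs (List.ofFn fun k => T k ^ x k).prod).trace.re ≤ ∏ k, (T k).trace.re ^ x k := by
  obtain ⟨W, hW, h⟩ := exists_contraction_mul_eq
    (nonneg_iff_posSemidef.1 (CFC.abs_nonneg (List.ofFn fun k => T k ^ x k).prod)).1
    (CFC.abs_mul_abs (List.ofFn fun k => T k ^ x k).prod)
  rw [h]
  refine (Complex.re_le_norm _).trans ?_
  choose U v hv hvx htr hpow using fun k => (hT k).exists_rpow_eq (x := x k)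
  simp only [hpow, ← htr]
  exact norm_trace_mul_prod_unitary_conj_le U v hv x hx hvx W hW

end Matrix

theorem theorem5p7 {n d : ℕ} (T : Fin n → Matrix (Fin d) (Fin d) ℂ)
    (hT : ∀ k, (T k).PosSemidef) (ϑ : Fin n → ℝ)
    (hϑ : ∀ k, 0 ≤ ϑ k ∧ ϑ k ≤ 1) (hsum : ∑ k, ϑ k = 1)
    (r : ℝ) (hr : IsLeast (Set.range ϑ) r) :
    (CFC.abs (List.ofFn fun k => T k ^ ϑ k).prod).trace.re +
        r * (∑ k, (T k).trace.re - (n : ℝ) * (∏ k, (T k).trace.re) ^ (1 / (n : ℝ)))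
      ≤ ∑ k, (ϑ k • T k).trace.re := by
  have hr₀ : 0 ≤ r := by
    obtain ⟨k, rfl⟩ := hr.1
    exact (hϑ k).1
  have hholder := Matrix.re_trace_abs_prod_rpow_le T hT ϑ ⟨fun k => (hϑ k).1, hsum⟩
  have hscalar := geom_mean_add_gap_le_arith_mean_weighted (fun k => (T k).trace.re) ϑ
    (fun k => (Complex.nonneg_iff.1 (hT k).trace_nonneg).1) hsum r hr₀
    (fun k => hr.2 ⟨k, rfl⟩)
  have htr : ∑ k, (ϑ k • T k).trace.re = ∑ k, ϑ k * (T k).trace.re := by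
    simp [Matrix.trace_smul]
  rw [htr]
  linarith
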